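/- Let $G=(N,E)$ be any finite simple undirected graph with $n=|N|$ vertices (agents). Given a payoff gain $\alpha\in\mathbb{R}$, each agent $i$ plays $a_i\in\{x,y\}$ and has utility $U_i(a)=\sum_{j:\{i,j\}\in E}u(a_i,a_j)$ with $u(x,x)=1+\alpha$, $u(y,y)=1$, $u(x,y)=u(y,x)=0$. If an adversary influences a set $S\subseteq N$, the utility becomes $\tilde U_i(a,S)=U_i(a)+1$ if $i\in S$ and $a_i=y$, and $\tilde U_i(a,S)=U_i(a)$ otherwise. For $k\in\{1,\dots,n\}$ and $\beta>0$, log-linear learning in the presence of a uniformly random adversary of capability $k$ is the Markov chain on $\{x,y\}^N$ in which, at each time step, an influence set $S$ is drawn uniformly from the $k$-element subsets of $N$ (independently across time), an agent $i$ is drawn uniformly from $N$ independently of $S$, and agent $i$ changes its action to $b\in\{x,y\}$ with probability proportional to $\exp\bigl(\beta\,\tilde U_i((b,a_{-i}),S)\bigr)$, all other agents keeping their actions. Let $\pi_\beta$ be the stationary distribution of this chain. The game $(G,\alpha)$ is called susceptible to $\mathrm{UR}(k)$ if the joint action $\vec y=(y,\dots,y)$ is strictly stochastically stable, i.e. $\lim_{\beta\to\infty}\pi_\beta(\vec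 y)=1$, and $$\alpha^{\rm sus}(G,\mathrm{UR}(k))=\sup\{\alpha\in\mathbb{R} : (G,\alpha)\text{ is susceptible to }\mathrm{UR}(k)\}\in[-\infty,\infty].$$ Then for every $k\in\{2,\dots,n-1\}$, $$\alpha^{\rm sus}(G,\mathrm{UR}(k))=\alpha^{\rm sus}(G,\mathrm{UR}(1)).$$ -/

import Mathlib

open Filter Topology

noncomputable section

namespace GraphCoord

/-- The two alternatives of the coordination game. -/
inductive Action where
  | x : Action
  | y : Action
  deriving DecidableEq

instance : Fintype Action where
  elems := {Action.x, Action.y}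
  complete := by intro b; cases b <;> simp

/-- Payoff matrix of the two-player coordination game with payoff gain `α`
(the row player's payoff; the game is symmetric). -/
def payoff (α : ℝ) : Action → Action → ℝ
  | .x, .x => 1 + α
  | .y, .y => 1
  | .x, .y => 0
  | .y, .x => 0

variable {V : Type*} [Fintype V] [DecidableEq V]

/-- Utility of agent `i` in the nominal graphical coordination game `(G, α)`:
the sum of the two-player payoffs over the neighbours of `i`. -/
def utility (G : SimpleGraph V) [DecidableRel G.Adj] (α : ℝ) (i : V) (a : V → Action) : ℝ :=
  ∑ j ∈ G.neighborFinset i, payoff α (a i) (a j)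

/-- Utility of agent `i` when the adversary influences the agents in `S`: an influenced agent
gets an additional payoff of `1` for playing `y`. -/
def influencedUtility (G : SimpleGraph V) [DecidableRel G.Adj] (α : ℝ) (S : Finset V)
    (i : V) (a : V → Action) : ℝ :=
  utility G α i a + if i ∈ S ∧ a i = Action.y then 1 else 0

/-- Log-linear learning: the probability that agent `i`, selected for revision at joint action `a`
while `S` is the influence set, chooses action `b`. -/
def choiceProb (G : SimpleGraph V) [DecidableRel G.Adj] (α β : ℝ) (S : Finset V)
    (i : V) (a : V → Action) (b : Action) : ℝ :=
  Real.exp (β * influencedUtility G α S i (Function.update a i b)) /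
    (Real.exp (β * influencedUtility G α S i (Function.update a i Action.x)) +
      Real.exp (β * influencedUtility G α S i (Function.update a i Action.y)))

/-- One-step transition probability of log-linear learning when the influence set is `S`:
an agent is selected uniformly at random and revises its action. -/
def stepProb (G : SimpleGraph V) [DecidableRel G.Adj] (α β : ℝ) (S : Finset V)
    (a a' : V → Action) : ℝ :=
  (1 / (Fintype.card V : ℝ)) * ∑ i : V, ∑ b : Action,
    if Function.update a i b = a' then choiceProb G α β S i a b else 0

/-- Transition matrix of log-linear learning in the presence of a uniformly random adversary of
capability `k`: at each time step the influence set is drawn afresh, uniformly from the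
`k`-element sets of agents. -/
def urMatrix (G : SimpleGraph V) [DecidableRel G.Adj] (α β : ℝ) (k : ℕ) :
    Matrix (V → Action) (V → Action) ℝ :=
  Matrix.of fun a a' =>
    (1 / ((Finset.powersetCard k (Finset.univ : Finset V)).card : ℝ)) *
      ∑ S ∈ Finset.powersetCard k (Finset.univ : Finset V), stepProb G α β S a a'

/-- `π` is a stationary probability distribution of the Markov chain with transition matrix `P`. -/
def IsStationaryDistribution {Ω : Type*} [Fintype Ω] (P : Matrix Ω Ω ℝ) (π : Ω → ℝ) : Prop :=
  π ∈ stdSimplex ℝ Ω ∧ Matrix.vecMul π P = π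

/-- A state `s` is strictly stochastically stable for the family of Markov chains `P β`, `β > 0`,
if the stationary distributions `π β` of `P β` put mass tending to `1` on `s` as `β → ∞`. -/
def StrictlyStochasticallyStable {Ω : Type*} [Fintype Ω] (P : ℝ → Matrix Ω Ω ℝ) (s : Ω) : Prop :=
  ∃ π : ℝ → Ω → ℝ, (∀ β : ℝ, 0 < β → IsStationaryDistribution (P β) (π β)) ∧
    Tendsto (fun β => π β s) atTop (𝓝 1)

/-- The game `(G, α)` is susceptible to a uniformly random adversary of capability `k`: the joint
action in which everybody plays `y` is strictly stochastically stable. -/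
def SusceptibleUR (G : SimpleGraph V) [DecidableRel G.Adj] (α : ℝ) (k : ℕ) : Prop :=
  StrictlyStochasticallyStable (fun β => urMatrix G α β k) (fun _ => Action.y)

/-- The susceptibility of `G` to a uniformly random adversary of capability `k`: the supremum, in
the extended reals, of the payoff gains `α` for which `(G, α)` is susceptible. -/
def susceptibilityUR (G : SimpleGraph V) [DecidableRel G.Adj] (k : ℕ) : EReal :=
  sSup {r : EReal | ∃ α : ℝ, r = (α : EReal) ∧ SusceptibleUR G α k}

end GraphCoord

end

/-!
The set of payoff gains for which the game is susceptible to `UR(k)` turns out to be the same for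
every `k` with `1 ≤ k < n`; equality of the suprema is then immediate.

Whether an agent's revision law is the influenced one or the nominal one depends only on whether
the agent belongs to the random influence set. When `1 ≤ k < n` both events have positive
probability, not depending on `β`, so the transition matrices for any two capabilities are
comparable entry by entry, with the factor `2 ^ n` uniformly in `β`
(`GraphCoord.urMatrix_le_urMatrix`).

Stationary distributions of comparable irreducible chains are comparable
(`FiniteMarkov.stationary_ratio_le`), again with a factor depending only on the entrywise factor
and the number of states. This would follow from the Markov chain tree theorem; it is obtained here
by replacing the rows of one matrix by those of the other one at a time. If only the row of the
state `a` changes, then the stationary distribution normalised to have mass `1` at `a` depends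
monotonically and linearly on that row, which is a comparison principle
(`FiniteMarkov.stationary_le_of_row_le`).

Consequently the mass that the stationary distribution puts outside of the state `(y, …, y)` tends
to `0` for one capability iff it does for the other.
-/

/-! ### Stationary distributions of finite Markov chains -/

namespace FiniteMarkov

open GraphCoord

variable {Ω : Type*}

/-- Irreducibility of a nonnegative matrix, in terms of closed sets: the only nonempty set of states
that cannot be left through entries that are positive is the whole state space. -/
def Irreducible (P : Matrix Ω Ω ℝ) : Prop :=
  ∀ S : Set Ω, S.Nonempty → (∀ a ∈ S, ∀ b, 0 < P a b → b ∈ S) → S = Set.univ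

lemma Irreducible.mono {P Q : Matrix Ω Ω ℝ} (hP : Irreducible P)
    (h : ∀ a b, 0 < P a b → 0 < Q a b) : Irreducible Q :=
  fun S hS hcl => hP S hS fun a ha b hab => hcl a ha b (h a b hab)

variable [Fintype Ω]

lemma stationary_sum {P : Matrix Ω Ω ℝ} {π : Ω → ℝ} (h : IsStationaryDistribution P π) (s : Ω) :
    ∑ t, π t * P t s = π s :=
  congrFun h.2 s

variable [DecidableEq Ω]

/-- A nonnegative measure that increases under a stochastic matrix is invariant, by comparison of
the total masses. -/
lemma sum_eq_of_le_sum {P : Matrix Ω Ω ℝ} (hP : P ∈ Matrix.rowStochastic ℝ Ω) {m : Ω → ℝ}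
    (hm : ∀ s, m s ≤ ∑ t, m t * P t s) (s : Ω) : ∑ t, m t * P t s = m s := by
  have htot : ∑ s, m s = ∑ s, ∑ t, m t * P t s := by
    rw [Finset.sum_comm]
    simp_rw [← Finset.mul_sum, Matrix.sum_row_of_mem_rowStochastic hP, mul_one]
  exact ((Finset.sum_eq_sum_iff_of_le fun s _ => hm s).1 htot s (Finset.mem_univ s)).symm

/-- For an irreducible chain, a nonnegative measure that increases under one step of the chain and
vanishes at one state vanishes identically: its support is closed. -/
lemma eq_zero_of_le_sum {P : Matrix Ω Ω ℝ} (hP : P ∈ Matrix.rowStochastic ℝ Ω)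
    (hirr : Irreducible P) {m : Ω → ℝ} (hnn : ∀ s, 0 ≤ m s) (hm : ∀ s, m s ≤ ∑ t, m t * P t s)
    {a : Ω} (ha : m a = 0) (s : Ω) : m s = 0 := by
  by_contra hs
  have huniv : {t | 0 < m t} = Set.univ := by
    refine hirr _ ⟨s, lt_of_le_of_ne (hnn s) (Ne.symm hs)⟩ fun t (ht : 0 < m t) b htb => ?_
    rw [Set.mem_ofPred_eq, ← sum_eq_of_le_sum hP hm b]
    exact (mul_pos ht htb).trans_le (Finset.single_le_sum (f := fun t => m t * P t b)
      (fun u _ => mul_nonneg (hnn u) (Matrix.nonneg_of_mem_rowStochastic hP)) (Finset.mem_univ t))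
  have : a ∈ {t | 0 < m t} := huniv ▸ Set.mem_univ a
  exact this.ne' ha

lemma stationary_pos {P : Matrix Ω Ω ℝ} (hP : P ∈ Matrix.rowStochastic ℝ Ω)
    (hirr : Irreducible P) {π : Ω → ℝ} (hπ : IsStationaryDistribution P π) (a : Ω) : 0 < π a := by
  refine lt_of_le_of_ne (hπ.1.1 a) fun ha => ?_
  have h0 := eq_zero_of_le_sum hP hirr hπ.1.1 (fun s => (stationary_sum hπ s).ge) ha.symm
  have h1 := hπ.1.2
  simp [h0] at h1

/-- Every stochastic matrix has a stationary distribution: take the absolute values of a left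
eigenvector for the eigenvalue `1`, and normalise. -/
lemma exists_stationary [Nonempty Ω] {P : Matrix Ω Ω ℝ} (hP : P ∈ Matrix.rowStochastic ℝ Ω) :
    ∃ π, IsStationaryDistribution P π := by
  obtain ⟨v, hv0, hv⟩ : ∃ v ≠ 0, Matrix.vecMul v (P - 1) = 0 := by
    rw [Matrix.exists_vecMul_eq_zero_iff, ← Matrix.exists_mulVec_eq_zero_iff]
    exact ⟨1, one_ne_zero, by rw [Matrix.sub_mulVec, hP.2, Matrix.one_mulVec, sub_self]⟩
  rw [Matrix.vecMul_sub, Matrix.vecMul_one, sub_eq_zero] at hv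
  have habs : ∀ s, |v s| ≤ ∑ t, |v t| * P t s := fun s => by
    rw [← congrFun hv s]
    refine (Finset.abs_sum_le_sum_abs _ _).trans_eq (Finset.sum_congr rfl fun t _ => ?_)
    rw [abs_mul, abs_of_nonneg (hP.1 t s)]
  have hpos : 0 < ∑ s, |v s| := by
    obtain ⟨s, hs⟩ := Function.ne_iff.1 hv0
    exact Finset.sum_pos' (fun _ _ => abs_nonneg _) ⟨s, Finset.mem_univ s, abs_pos.2 hs⟩
  refine ⟨fun s => |v s| / ∑ t, |v t|, ⟨fun s => by positivity, ?_⟩, ?_⟩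
  · rw [← Finset.sum_div, div_self hpos.ne']
  · ext s
    have := sum_eq_of_le_sum hP habs s
    simp only [Matrix.vecMul, dotProduct, div_mul_eq_mul_div]
    rw [← Finset.sum_div, this]

/-! ### Comparison of stationary distributions -/

/-- The comparison principle. If `Q` differs from `P` only in the row of `a`, where it is at most
`C` times as large, then its stationary distribution, normalised to have mass `1` at `a`, is at
most `C` times that of `P`. -/
lemma stationary_le_of_row_le {P Q : Matrix Ω Ω ℝ} (hP : P ∈ Matrix.rowStochastic ℝ Ω)
    (hirr : Irreducible P) {C : ℝ} (hC : 1 ≤ C) {a : Ω} (hrow : ∀ t, t ≠ a → ∀ s, Q t s = P t s)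
    (ha : ∀ s, Q a s ≤ C * P a s) {π ρ : Ω → ℝ} (hπ : IsStationaryDistribution P π)
    (hρ : IsStationaryDistribution Q ρ) (s : Ω) : ρ s * π a ≤ C * (π s * ρ a) := by
  -- The negative part `m` of `C • ρ a • π - π a • ρ` vanishes at `a` and increases under `P`.
  set d : Ω → ℝ := fun s => ρ s * π a - C * (π s * ρ a) with hd
  set m : Ω → ℝ := fun s => max (d s) 0 with hm
  have hpa : 0 ≤ π a * ρ a := mul_nonneg (hπ.1.1 a) (hρ.1.1 a)
  have hda : m a = 0 := by
    refine max_eq_right ?_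
    simp only [hd]
    nlinarith
  have hle : ∀ s, d s ≤ ∑ t, m t * P t s := fun s => by
    have h1 : d s = ∑ t, (ρ t * Q t s * π a - C * (π t * P t s * ρ a)) := by
      rw [Finset.sum_sub_distrib, ← Finset.mul_sum, ← Finset.sum_mul, ← Finset.sum_mul,
        stationary_sum hπ, stationary_sum hρ]
    rw [h1]
    refine Finset.sum_le_sum fun t _ => ?_
    by_cases hta : t = a
    · subst hta
      rw [hda]
      nlinarith [mul_le_mul_of_nonneg_left (ha s) hpa]
    · rw [hrow t hta]
      calc ρ t * P t s * π a - C * (π t * P t s * ρ a) = d t * P t s := by simp only [hd]; ring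
        _ ≤ m t * P t s := mul_le_mul_of_nonneg_right (le_max_left _ _) (hP.1 t s)
  have hm0 := eq_zero_of_le_sum hP hirr (m := m) (fun _ => le_max_right _ _)
    (fun s => max_le (hle s) (Finset.sum_nonneg fun t _ =>
      mul_nonneg (le_max_right _ _) (hP.1 t s))) hda s
  have : d s ≤ m s := le_max_left _ _
  simp only [hd] at this
  linarith

/-- Changing a single row by a factor of at most `C` in both directions changes the ratio of the
stationary masses of any two states by a factor of at most `C ^ 2`. -/
lemma stationary_ratio_le_of_row {P Q : Matrix Ω Ω ℝ} (hP : P ∈ Matrix.rowStochastic ℝ Ω)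
    (hQ : Q ∈ Matrix.rowStochastic ℝ Ω) (hPirr : Irreducible P) (hQirr : Irreducible Q) {C : ℝ}
    (hC : 1 ≤ C) {a : Ω} (hrow : ∀ t, t ≠ a → ∀ s, Q t s = P t s)
    (hQP : ∀ s, Q a s ≤ C * P a s) (hPQ : ∀ s, P a s ≤ C * Q a s) {π ρ : Ω → ℝ}
    (hπ : IsStationaryDistribution P π) (hρ : IsStationaryDistribution Q ρ) (s t : Ω) :
    ρ s * π t ≤ C ^ 2 * (π s * ρ t) := by
  have h1 := stationary_le_of_row_le hP hPirr hC hrow hQP hπ hρ s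
  have h2 := stationary_le_of_row_le hQ hQirr hC (fun t ht s => (hrow t ht s).symm) hPQ hρ hπ t
  have hpos : 0 < π a * ρ a :=
    mul_pos (stationary_pos hP hPirr hπ a) (stationary_pos hQ hQirr hρ a)
  have hnn : 0 ≤ C * (π s * ρ a) :=
    mul_nonneg (by linarith) (mul_nonneg (hπ.1.1 s) (hρ.1.1 a))
  refine le_of_mul_le_mul_right ?_ hpos
  calc ρ s * π t * (π a * ρ a) = (ρ s * π a) * (π t * ρ a) := by ring
    _ ≤ (C * (π s * ρ a)) * (C * (ρ t * π a)) :=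
      mul_le_mul h1 h2 (mul_nonneg (hπ.1.1 t) (hρ.1.1 a)) hnn
    _ = C ^ 2 * (π s * ρ t) * (π a * ρ a) := by ring

/-- Stationary distributions of irreducible stochastic matrices that agree entrywise up to a factor
`C` agree, up to normalisation, up to a factor `(C ^ 2) ^ card Ω`. -/
theorem stationary_ratio_le {P Q : Matrix Ω Ω ℝ} (hP : P ∈ Matrix.rowStochastic ℝ Ω)
    (hQ : Q ∈ Matrix.rowStochastic ℝ Ω) (hirr : Irreducible P) {C : ℝ} (hC : 1 ≤ C)
    (hQP : ∀ a b, Q a b ≤ C * P a b) (hPQ : ∀ a b, P a b ≤ C * Q a b) {π ρ : Ω → ℝ}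
    (hπ : IsStationaryDistribution P π) (hρ : IsStationaryDistribution Q ρ) (s t : Ω) :
    ρ s * π t ≤ (C ^ 2) ^ Fintype.card Ω * (π s * ρ t) := by
  have : Nonempty Ω := ⟨s⟩
  -- `H F` has the rows of `Q` at the states in `F`, and those of `P` elsewhere.
  let H : Finset Ω → Matrix Ω Ω ℝ := fun F => Matrix.of fun a b => if a ∈ F then Q a b else P a b
  have hH : ∀ F, H F ∈ Matrix.rowStochastic ℝ Ω := fun F => by
    rw [Matrix.mem_rowStochastic_iff_sum] at hP hQ ⊢
    constructor
    · intro a b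
      by_cases ha : a ∈ F <;> simp [H, ha, hP.1, hQ.1]
    · intro a
      by_cases ha : a ∈ F <;> simp [H, ha, hP.2, hQ.2]
  have hHirr : ∀ F, Irreducible (H F) := fun F => hirr.mono fun a b hab => by
    by_cases ha : a ∈ F
    · simp only [H, Matrix.of_apply, ha, if_true]
      exact pos_of_mul_pos_right (hab.trans_le (hPQ a b)) (by linarith)
    · simpa [H, ha] using hab
  have key : ∀ (F : Finset Ω) (σ : Ω → ℝ), IsStationaryDistribution (H F) σ →
      σ s * π t ≤ (C ^ 2) ^ F.card * (π s * σ t) := by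
    intro F
    induction F using Finset.induction_on with
    | empty =>
      intro σ hσ
      have hHP : H ∅ = P := by ext; simp [H]
      rw [hHP] at hσ
      simpa using stationary_le_of_row_le hP hirr le_rfl (a := t) (fun _ _ _ => rfl)
        (fun _ => (one_mul _).ge) hπ hσ s
    | insert a F ha ih =>
      intro τ hτ
      obtain ⟨σ, hσ⟩ := exists_stationary (hH F)
      have h1 := ih σ hσ
      have h2 : τ s * σ t ≤ C ^ 2 * (σ s * τ t) := by
        refine stationary_ratio_le_of_row (hH F) (hH _) (hHirr F) (hHirr _) hC (a := a) ?_ ?_ ?_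
          hσ hτ s t
        · intro u hu b
          simp [H, hu]
        · intro b
          simpa [H, ha] using hQP a b
        · intro b
          simpa [H, ha] using hPQ a b
      have hσs := stationary_pos (hH F) (hHirr F) hσ s
      have hσt := stationary_pos (hH F) (hHirr F) hσ t
      rw [Finset.card_insert_of_notMem ha]
      refine le_of_mul_le_mul_right ?_ (mul_pos hσs hσt)
      calc τ s * π t * (σ s * σ t) = (τ s * σ t) * (σ s * π t) := by ring
        _ ≤ (C ^ 2 * (σ s * τ t)) * ((C ^ 2) ^ F.card * (π s * σ t)) :=
          mul_le_mul h2 h1 (mul_nonneg hσs.le (hπ.1.1 t))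
            (mul_nonneg (sq_nonneg C) (mul_nonneg hσs.le (hτ.1.1 t)))
        _ = (C ^ 2) ^ (F.card + 1) * (π s * τ t) * (σ s * σ t) := by ring
  refine key Finset.univ ρ ?_
  have hHQ : H Finset.univ = Q := by ext; simp [H]
  rwa [hHQ]

/-- Strict stochastic stability carries over between families of irreducible chains that are
entrywise comparable uniformly in the parameter. -/
theorem strictlyStochasticallyStable_of_comparable {P Q : ℝ → Matrix Ω Ω ℝ}
    (hP : ∀ β, P β ∈ Matrix.rowStochastic ℝ Ω) (hQ : ∀ β, Q β ∈ Matrix.rowStochastic ℝ Ω)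
    (hirr : ∀ β, Irreducible (P β)) {C : ℝ} (hC : 1 ≤ C)
    (hQP : ∀ β a b, Q β a b ≤ C * P β a b) (hPQ : ∀ β a b, P β a b ≤ C * Q β a b) {s : Ω}
    (h : StrictlyStochasticallyStable P s) : StrictlyStochasticallyStable Q s := by
  have : Nonempty Ω := ⟨s⟩
  obtain ⟨π, hπ, hlim⟩ := h
  choose ρ hρ using fun β => exists_stationary (hQ β)
  refine ⟨ρ, fun β _ => hρ β, ?_⟩
  set K := (C ^ 2) ^ Fintype.card Ω with hK
  have hK0 : 0 ≤ K := by positivity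
  have hρ1 : ∀ β, ρ β s ≤ 1 := fun β =>
    (hρ β).1.2 ▸ Finset.single_le_sum (fun u _ => (hρ β).1.1 u) (Finset.mem_univ s)
  -- The masses of the complement of `s` under `π β` and `ρ β` are comparable.
  have hbound : ∀ β, 0 < β → 1 - K * (1 - π β s) / π β s ≤ ρ β s := fun β hβ => by
    have hs := stationary_pos (hP β) (hirr β) (hπ β hβ) s
    have hsum : ∀ μ : Ω → ℝ, ∑ u, μ u = 1 → 1 - μ s = ∑ u ∈ Finset.univ.erase s, μ u :=
      fun μ hμ => by rw [← hμ, ← Finset.sum_erase_add _ _ (Finset.mem_univ s), add_sub_cancel_right]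
    have hmain : (1 - ρ β s) * π β s ≤ K * (1 - π β s) := by
      rw [hsum _ (hρ β).1.2, hsum _ (hπ β hβ).1.2, Finset.sum_mul, Finset.mul_sum]
      refine Finset.sum_le_sum fun u _ => ?_
      refine (stationary_ratio_le (hP β) (hQ β) (hirr β) hC (hQP β) (hPQ β) (hπ β hβ) (hρ β)
        u s).trans ?_
      exact mul_le_mul_of_nonneg_left
        (mul_le_of_le_one_right ((hπ β hβ).1.1 u) (hρ1 β)) hK0
    have := (le_div_iff₀ hs).2 hmain
    linarith
  have hlow : Tendsto (fun β => 1 - K * (1 - π β s) / π β s) atTop (𝓝 1) := by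
    simpa using (tendsto_const_nhds (x := (1 : ℝ))).sub
      ((((tendsto_const_nhds (x := (1 : ℝ))).sub hlim).const_mul K).div hlim one_ne_zero)
  refine tendsto_of_tendsto_of_tendsto_of_le_of_le' hlow tendsto_const_nhds ?_
    (Eventually.of_forall hρ1)
  filter_upwards [eventually_gt_atTop 0] with β hβ using hbound β hβ

end FiniteMarkov

/-! ### Transition probabilities for different capabilities -/

namespace GraphCoord

open Finset

variable {V : Type*} [Fintype V]

lemma card_powersetCard_pos {k : ℕ} (hkn : k < Fintype.card V) :
    (0 : ℝ) < (powersetCard k (univ : Finset V)).card := by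
  rw [Nat.cast_pos, card_pos, powersetCard_nonempty]
  simpa using hkn.le

variable [DecidableEq V] (G : SimpleGraph V) [DecidableRel G.Adj]

lemma choiceProb_pos (α β : ℝ) (S : Finset V) (i : V) (a : V → Action) (b : Action) :
    0 < choiceProb G α β S i a b := by
  unfold choiceProb
  positivity

lemma sum_choiceProb (α β : ℝ) (S : Finset V) (i : V) (a : V → Action) :
    ∑ b, choiceProb G α β S i a b = 1 := by
  have huniv : (univ : Finset Action) = {Action.x, Action.y} := rfl
  rw [huniv, sum_pair (by decide)]
  unfold choiceProb
  rw [← add_div, div_self (by positivity)]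

lemma choiceProb_congr {α β : ℝ} {S T : Finset V} {i : V} (h : i ∈ S ↔ i ∈ T) (a : V → Action)
    (b : Action) : choiceProb G α β S i a b = choiceProb G α β T i a b := by
  simp only [choiceProb, influencedUtility, h]

lemma stepProb_nonneg (α β : ℝ) (S : Finset V) (a a' : V → Action) :
    0 ≤ stepProb G α β S a a' := by
  refine mul_nonneg (by positivity) (sum_nonneg fun i _ => sum_nonneg fun b _ => ?_)
  split_ifs
  exacts [(choiceProb_pos G α β S i a b).le, le_rfl]

lemma sum_stepProb [Nonempty V] (α β : ℝ) (S : Finset V) (a : V → Action) :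
    ∑ a', stepProb G α β S a a' = 1 := by
  have hinner : ∀ i : V, ∑ a' : V → Action, ∑ b : Action,
      (if Function.update a i b = a' then choiceProb G α β S i a b else 0) = 1 := fun i => by
    rw [sum_comm]
    simpa using sum_choiceProb G α β S i a
  simp only [stepProb]
  rw [← mul_sum, sum_comm, sum_congr rfl fun i _ => hinner i]
  simp

lemma stepProb_update_pos (α β : ℝ) (S : Finset V) (a : V → Action) (i : V) (b : Action) :
    0 < stepProb G α β S a (Function.update a i b) := by
  have : Nonempty V := ⟨i⟩
  have hnn : ∀ (j : V) (c : Action), 0 ≤ (if Function.update a j c = Function.update a i b then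
      choiceProb G α β S j a c else 0) := fun j c => by
    split_ifs
    exacts [(choiceProb_pos G α β S j a c).le, le_rfl]
  refine mul_pos (by positivity) (sum_pos' (fun j _ => sum_nonneg fun c _ => hnn j c)
    ⟨i, mem_univ i, sum_pos' (fun c _ => hnn i c) ⟨b, mem_univ b, ?_⟩⟩)
  rw [if_pos rfl]
  exact choiceProb_pos G α β S i a b

/-- Each agent revises either as if nobody, or as if everybody were influenced. -/
lemma stepProb_le_add (α β : ℝ) (S : Finset V) (a a' : V → Action) :
    stepProb G α β S a a' ≤ stepProb G α β ∅ a a' + stepProb G α β univ a a' := by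
  simp only [stepProb]
  rw [← mul_add, ← sum_add_distrib]
  refine mul_le_mul_of_nonneg_left (sum_le_sum fun i _ => ?_) (by positivity)
  rw [← sum_add_distrib]
  refine sum_le_sum fun b _ => ?_
  split_ifs
  · have h0 := choiceProb_pos G α β ∅ i a b
    have h1 := choiceProb_pos G α β univ i a b
    by_cases hi : i ∈ S
    · rw [choiceProb_congr G (T := univ) (by simp [hi])]
      linarith
    · rw [choiceProb_congr G (T := ∅) (by simp [hi])]
      linarith
  · simp

/-- For `1 ≤ k < n` every agent is in some influence set of size `k`, and outside of another. -/
lemma add_le_sum_stepProb {k : ℕ} (hk : 1 ≤ k) (hkn : k < Fintype.card V) (α β : ℝ)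
    (a a' : V → Action) :
    stepProb G α β ∅ a a' + stepProb G α β univ a a' ≤
      ∑ S ∈ powersetCard k univ, stepProb G α β S a a' := by
  simp only [stepProb]
  rw [← mul_add, ← sum_add_distrib, ← mul_sum, sum_comm]
  refine mul_le_mul_of_nonneg_left (sum_le_sum fun i _ => ?_) (by positivity)
  rw [← sum_add_distrib, sum_comm]
  refine sum_le_sum fun b _ => ?_
  split_ifs
  · obtain ⟨S, hiS, -, hS⟩ := exists_subsuperset_card_eq (subset_univ {i})
      (by simpa using hk) (by simpa using hkn.le)
    obtain ⟨T, hTi, hT⟩ := exists_subset_card_eq (s := univ.erase i) (n := k)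
      (by rw [card_erase_of_mem (mem_univ i), card_univ]; omega)
    have hiS : i ∈ S := hiS (mem_singleton_self i)
    have hiT : i ∉ T := fun h => (mem_erase.1 (hTi h)).1 rfl
    have hTS : T ≠ S := fun h => hiT (h ▸ hiS)
    rw [choiceProb_congr G (S := ∅) (T := T) (by simp [hiT]),
      choiceProb_congr G (S := univ) (T := S) (by simp [hiS]),
      ← sum_pair (f := fun R => choiceProb G α β R i a b) hTS]
    refine sum_le_sum_of_subset_of_nonneg ?_ fun R _ _ => (choiceProb_pos G α β R i a b).le
    simp [insert_subset_iff, hS, hT]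
  · simp

lemma urMatrix_mem_rowStochastic {k : ℕ} (hkn : k < Fintype.card V) (α β : ℝ) :
    urMatrix G α β k ∈ Matrix.rowStochastic ℝ (V → Action) := by
  have : Nonempty V := Fintype.card_pos_iff.1 (by omega)
  have hc := card_powersetCard_pos hkn
  rw [Matrix.mem_rowStochastic_iff_sum]
  simp only [urMatrix, Matrix.of_apply]
  constructor
  · exact fun a a' => mul_nonneg (by positivity) (sum_nonneg fun S _ => stepProb_nonneg ..)
  · intro a
    rw [← mul_sum, sum_comm]
    simp only [sum_stepProb, sum_const, nsmul_eq_mul, mul_one]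
    exact one_div_mul_cancel hc.ne'

lemma urMatrix_update_pos {k : ℕ} (hkn : k < Fintype.card V) (α β : ℝ) (a : V → Action) (i : V)
    (b : Action) : 0 < urMatrix G α β k a (Function.update a i b) := by
  have hc := card_powersetCard_pos hkn
  exact mul_pos (by positivity) (sum_pos (fun S _ => stepProb_update_pos G α β S a i b)
    (card_pos.1 (by exact_mod_cast hc)))

lemma urMatrix_irreducible {k : ℕ} (hkn : k < Fintype.card V) (α β : ℝ) :
    FiniteMarkov.Irreducible (urMatrix G α β k) := by
  rintro S ⟨a, ha⟩ hcl
  refine Set.eq_univ_of_forall fun a' => ?_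
  -- Change the actions of the agents from `a` to `a'` one by one.
  have key : ∀ F : Finset V, F.piecewise a' a ∈ S := fun F => by
    induction F using Finset.induction_on with
    | empty => simpa using ha
    | insert i F _ ih =>
      rw [piecewise_insert]
      exact hcl _ ih _ (urMatrix_update_pos G hkn α β _ i _)
  simpa using key univ

/-- The transition matrices for any two capabilities strictly between `0` and `n` are comparable,
uniformly in `β`. -/
lemma urMatrix_le_urMatrix {j k : ℕ} (hjn : j < Fintype.card V) (hk : 1 ≤ k)
    (hkn : k < Fintype.card V) (α β : ℝ) (a a' : V → Action) :
    urMatrix G α β j a a' ≤ 2 ^ Fintype.card V * urMatrix G α β k a a' := by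
  have hcj := card_powersetCard_pos hjn
  have hck := card_powersetCard_pos hkn
  have hck2 : ((powersetCard k (univ : Finset V)).card : ℝ) ≤ 2 ^ Fintype.card V := by
    rw [card_powersetCard, card_univ]
    exact_mod_cast Nat.choose_le_two_pow _ _
  set A := ∑ S ∈ powersetCard k univ, stepProb G α β S a a' with hA
  have hA0 : 0 ≤ A := sum_nonneg fun S _ => stepProb_nonneg ..
  have hj : urMatrix G α β j a a' ≤ A := by
    simp only [urMatrix, Matrix.of_apply]
    rw [one_div, inv_mul_le_iff₀ hcj, ← nsmul_eq_mul]
    exact sum_le_card_nsmul _ _ _ fun S _ =>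
      (stepProb_le_add G α β S a a').trans (add_le_sum_stepProb G hk hkn α β a a')
  refine hj.trans ?_
  simp only [urMatrix, Matrix.of_apply]
  rw [← hA, ← mul_assoc, mul_one_div]
  exact le_mul_of_one_le_left hA0 ((one_le_div hck).2 hck2)

lemma SusceptibleUR.of_capability {G : SimpleGraph V} [DecidableRel G.Adj] {α : ℝ} {j k : ℕ}
    (hj : 1 ≤ j) (hjn : j < Fintype.card V) (hk : 1 ≤ k) (hkn : k < Fintype.card V)
    (h : SusceptibleUR G α j) : SusceptibleUR G α k :=
  FiniteMarkov.strictlyStochasticallyStable_of_comparable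
    (fun β => urMatrix_mem_rowStochastic G hjn α β) (fun β => urMatrix_mem_rowStochastic G hkn α β)
    (fun β => urMatrix_irreducible G hjn α β) (one_le_pow₀ one_le_two)
    (fun β => urMatrix_le_urMatrix G hkn hj hjn α β)
    (fun β => urMatrix_le_urMatrix G hjn hk hkn α β) h

end GraphCoord

theorem theorem3 {V : Type*} [Fintype V] [DecidableEq V] (G : SimpleGraph V)
    [DecidableRel G.Adj] (k : ℕ) (hk2 : 2 ≤ k) (hkn : k ≤ Fintype.card V - 1) :
    GraphCoord.susceptibilityUR G k = GraphCoord.susceptibilityUR G 1 := by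
  have h : ∀ α, GraphCoord.SusceptibleUR G α k ↔ GraphCoord.SusceptibleUR G α 1 := fun α =>
    ⟨.of_capability (by omega) (by omega) le_rfl (by omega),
      .of_capability le_rfl (by omega) (by omega) (by omega)⟩
  simp only [GraphCoord.susceptibilityUR, h]
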